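/- Let $X$ be a proper CAT(0) space and let $x_0\in X$. Let $\overline X=X\cup\partial X$ be the compactification of $X$ by its visual boundary $\partial X$ (the set of asymptote classes of geodesic rays in $X$), with the cone topology based at $x_0$: it is generated by the open balls of $X$ and the sets $U(c,r,\varepsilon)$, where $c$ is a geodesic ray with $c(0)=x_0$, $r>0$, $\varepsilon>0$, and $U(c,r,\varepsilon)$ consists of all $x\in X$ with $d(x_0,x)>r$ such that the point at distance $r$ from $x_0$ on the geodesic from $x_0$ to $x$ is at distance less than $\varepsilon$ from $c(r)$, and of all points of $\partial X$ represented by a geodesic ray $c'$ with $c'(0)=x_0$ and $d(c'(r),c(r))<\varepsilon$. For $k\ge 1$, an integral $(k,k)$-quasi-geodesic originating at a point $p\in X$ is a function $h$ from $\{1,\dots,N\}$, or (a ray) from $\{1,2,\dots\}$, to $X$ with $h(1)=p$ and $\frac{|i-j|}{k}-k\le d(h(i),h(j))\le k|i-j|+k$ for all $i,j$ in its domain. A bounded continuous function $f:X\to\mathbb C$ is geometrically slowly oscillating if 1. $|f(x_n)-f(y_n)|\to 0$ for all sequences $(x_n)$, $(y_n)$ in $X$ such that $x_n\to\infty$ (i.e.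 $x_n$ eventually leaves every bounded set) and $\sup_n d(x_n,y_n)<\infty$; and 2. for every real $k\ge 1$, every integral $(k,k)$-quasi-geodesic ray $g$ in $X$ and every $\varepsilon>0$ there is $m\ge1$ such that the set of all values $f(h(i))$ has diameter less than $\varepsilon$, where $h$ ranges over the (finite or infinite) integral $(k,k)$-quasi-geodesics with $h(j)=g(j)$ for $1\le j\le m$, and $i\ge m$ over the elements of the domain of $h$. Let $C_{QG}(X)$ be the algebra of these functions with the supremum norm. The quasi-geodesic compactification $X_{QG}$ is its maximal ideal space (the space of characters of $C_{QG}(X)$ with the Gelfand topology), a point $x\in X$ being identified with the character $f\mapsto f(x)$, and $\partial_{QG}X=X_{QG}\setminus X$. **Proposition 4.15.** There is a continuous surjection $F:\overline X\to X_{QG}$ with $F(x)=x$ for all $x\in X$ and $F(\partial X)=\partial_{QG}X$. -/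

import Mathlib

open Filter Topology Bornology BoundedContinuousFunction
open scoped NNReal

universe u

/-- A metric space is geodesic if any two points are the endpoints of a path parametrized by
arc length on `[0, dist x y]` that is an isometric embedding of that interval. -/
def IsGeodesicSpace (X : Type u) [MetricSpace X] : Prop :=
  ∀ x y : X, ∃ γ : ℝ → X, γ 0 = x ∧ γ (dist x y) = y ∧
    ∀ s ∈ Set.Icc 0 (dist x y), ∀ t ∈ Set.Icc 0 (dist x y), dist (γ s) (γ t) = |s - t|

/-- `z` lies on a geodesic segment from `x` to `y` (in a geodesic space this is the case exactly
when the triangle inequality is an equality). -/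
def OnGeodesic {X : Type u} [MetricSpace X] (x y z : X) : Prop :=
  dist x z + dist z y = dist x y

/-- A CAT(0) space: a geodesic space all of whose geodesic triangles are at least as thin as their
comparison triangles in the Euclidean plane. Here `x` and `y` are points on the sides `[p, q]` and
`[p, r]` of a geodesic triangle with vertices `p, q, r`; `p', q', r'` is a comparison triangle, and
`x', y'` are the comparison points of `x, y`. (All pairs of sides occur by permuting the vertices;
for two points on one geodesic side the inequality is trivially an equality.) -/
structure IsCAT0Space (X : Type u) [MetricSpace X] : Prop where
  geodesic : IsGeodesicSpace X
  thin : ∀ (p q r x y : X) (p' q' r' x' y' : EuclideanSpace ℝ (Fin 2)),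
    OnGeodesic p q x → OnGeodesic p r y →
    dist p' q' = dist p q → dist p' r' = dist p r → dist q' r' = dist q r →
    dist p' x' = dist p x → dist x' q' = dist x q →
    dist p' y' = dist p y → dist y' r' = dist y r →
    dist x y ≤ dist x' y'

/-! ### The visual boundary and the visual compactification -/

/-- A geodesic ray: an isometric embedding of `[0, ∞)`. -/
structure GeodesicRay (X : Type u) [MetricSpace X] where
  toFun : ℝ≥0 → X
  isometry : Isometry toFun

instance {X : Type u} [MetricSpace X] : CoeFun (GeodesicRay X) (fun _ => ℝ≥0 → X) :=
  ⟨GeodesicRay.toFun⟩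

/-- Two geodesic rays are asymptotic if they stay at bounded distance from each other. -/
def GeodesicRay.asymptoticSetoid (X : Type u) [MetricSpace X] : Setoid (GeodesicRay X) where
  r c c' := ∃ K : ℝ, ∀ t : ℝ≥0, dist (c t) (c' t) ≤ K
  iseqv :=
    { refl := fun c => ⟨0, fun t => by simp⟩
      symm := fun ⟨K, h⟩ => ⟨K, fun t => by rw [dist_comm]; exact h t⟩
      trans := fun ⟨K, h⟩ ⟨L, h'⟩ =>
        ⟨K + L, fun t => (dist_triangle _ _ _).trans (add_le_add (h t) (h' t))⟩ }

/-- The visual boundary: asymptote classes of geodesic rays. -/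
def VisualBoundary (X : Type u) [MetricSpace X] : Type u :=
  Quotient (GeodesicRay.asymptoticSetoid X)

/-- The point at infinity of a geodesic ray. -/
def GeodesicRay.endpoint {X : Type u} [MetricSpace X] (c : GeodesicRay X) : VisualBoundary X :=
  Quotient.mk (GeodesicRay.asymptoticSetoid X) c

/-- The set `X ∪ ∂X`, to be topologized by the cone topology based at `x₀`. -/
inductive VisualCompactification {X : Type u} [MetricSpace X] (x₀ : X) : Type u
  | point (x : X) : VisualCompactification x₀
  | boundary (ξ : VisualBoundary X) : VisualCompactification x₀

namespace VisualCompactification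

variable {X : Type u} [MetricSpace X] {x₀ : X}

/-- `IsProjection r z y` says that `y` is the radial projection of `z ∈ X ∪ ∂X`, a point farther
than `r` from `x₀`, to the sphere of radius `r` about `x₀`: the point at distance `r` from `x₀`
on a geodesic from `x₀` to `z`. -/
def IsProjection (r : ℝ≥0) : VisualCompactification x₀ → X → Prop
  | point x, y => r < dist x₀ x ∧ dist x₀ y = r ∧ OnGeodesic x₀ x y
  | boundary ξ, y => ∃ c : GeodesicRay X, c 0 = x₀ ∧ c.endpoint = ξ ∧ c r = y

/-- The basic neighbourhood `U(c, r, ε)` of the point at infinity of a ray `c` issuing from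
`x₀`. -/
def coneNhd (c : GeodesicRay X) (r : ℝ≥0) (ε : ℝ) : Set (VisualCompactification x₀) :=
  {z | ∃ y, IsProjection r z y ∧ dist y (c r) < ε}

/-- The cone topology, generated by the open balls of `X` and the sets `U(c, r, ε)` for the
geodesic rays `c` issuing from `x₀`. -/
instance coneTopology : TopologicalSpace (VisualCompactification x₀) :=
  TopologicalSpace.generateFrom
    ({U | ∃ (x : X) (ρ : ℝ), U = point '' Metric.ball x ρ} ∪
     {U | ∃ (c : GeodesicRay X) (r : ℝ≥0) (ε : ℝ),
        c 0 = x₀ ∧ 0 < r ∧ 0 < ε ∧ U = coneNhd c r ε})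

end VisualCompactification

/-! ### Integral quasi-geodesics and geometrically slowly oscillating functions -/

/-- `g`, restricted to the set `S` of integers, is an integral `(q, Q)`-quasi-geodesic. -/
def IsIntegralQuasiGeodesicOn {X : Type u} [MetricSpace X] (q Q : ℝ) (g : ℕ → X) (S : Set ℕ) :
    Prop :=
  ∀ i ∈ S, ∀ j ∈ S, |(i : ℝ) - j| / q - Q ≤ dist (g i) (g j) ∧
    dist (g i) (g j) ≤ q * |(i : ℝ) - j| + Q

/-- The domain `{1, 2, …}` (of length `N ≤ ∞`) of a quasi-geodesic originating at a point. -/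
def initialDomain (N : ℕ∞) : Set ℕ := {i | 1 ≤ i ∧ (i : ℕ∞) ≤ N}

/-- An integral `(q, Q)`-quasi-geodesic ray, originating at `g 1`. The value `g 0` is irrelevant. -/
def IsIntegralQuasiGeodesicRay {X : Type u} [MetricSpace X] (q Q : ℝ) (g : ℕ → X) : Prop :=
  IsIntegralQuasiGeodesicOn q Q g (initialDomain ⊤)

/-- The `m`-cone (`m ≥ 1`) of `g`: all points `h i` with `i ≥ m`, where `h` is a finite or infinite
integral `(q, Q)`-quasi-geodesic that agrees with `g` on `{1, …, m}`; in particular `h` has the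
same origin as `g`. -/
def quasiGeodesicCone {X : Type u} [MetricSpace X] (q Q : ℝ) (g : ℕ → X) (m : ℕ) : Set X :=
  {x | ∃ (N : ℕ∞) (h : ℕ → X), IsIntegralQuasiGeodesicOn q Q h (initialDomain N) ∧
    (∀ i, 1 ≤ i → i ≤ m → h i = g i) ∧ ∃ i ∈ initialDomain N, m ≤ i ∧ h i = x}

/-- Slowly oscillating functions. -/
def SlowlyOscillating {X : Type u} [MetricSpace X] (f : X → ℂ) : Prop :=
  ∀ (x y : ℕ → X) (M : ℝ), Tendsto x atTop (cobounded X) → (∀ n, dist (x n) (y n) < M) →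
    Tendsto (fun n => dist (f (x n)) (f (y n))) atTop (𝓝 0)

/-- Geometrically slowly oscillating functions: bounded continuous slowly oscillating functions
whose oscillation on the `m`-cone of every quasi-geodesic ray tends to `0` as `m` grows. -/
def GeometricallySlowlyOscillating {X : Type u} [MetricSpace X] (f : X →ᵇ ℂ) : Prop :=
  SlowlyOscillating f ∧
    ∀ (k : ℝ) (g : ℕ → X) (ε : ℝ), 1 ≤ k → IsIntegralQuasiGeodesicRay k k g → 0 < ε →
      ∃ m : ℕ, 1 ≤ m ∧ Metric.diam (f '' quasiGeodesicCone k k g m) < ε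

/-! ### The algebra of geometrically slowly oscillating functions -/

theorem quasiGeodesicCone_anti {X : Type u} [MetricSpace X] (q Q : ℝ) (g : ℕ → X) {m n : ℕ}
    (hmn : m ≤ n) : quasiGeodesicCone q Q g n ⊆ quasiGeodesicCone q Q g m := by
  rintro x ⟨N, h, h1, h2, i, hi, hni, rfl⟩
  exact ⟨N, h, h1, fun j hj hjm => h2 j hj (hjm.trans hmn), i, hi, hmn.trans hni, rfl⟩

/-- The condition on diameters, restated with pairs of points. -/
theorem geometricallySlowlyOscillating_iff {X : Type u} [MetricSpace X] (f : X →ᵇ ℂ) :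
    GeometricallySlowlyOscillating f ↔ SlowlyOscillating f ∧
      ∀ (k : ℝ) (g : ℕ → X) (ε : ℝ), 1 ≤ k → IsIntegralQuasiGeodesicRay k k g → 0 < ε →
        ∃ m : ℕ, 1 ≤ m ∧ ∀ x ∈ quasiGeodesicCone k k g m, ∀ y ∈ quasiGeodesicCone k k g m,
          dist (f x) (f y) < ε := by
  refine and_congr_right fun _ => ⟨fun H k g ε hk hg hε => ?_, fun H k g ε hk hg hε => ?_⟩
  · obtain ⟨m, hm, hd⟩ := H k g ε hk hg hε
    refine ⟨m, hm, fun x hx y hy => lt_of_le_of_lt ?_ hd⟩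
    exact Metric.dist_le_diam_of_mem (f.isBounded_image _) ⟨x, hx, rfl⟩ ⟨y, hy, rfl⟩
  · obtain ⟨m, hm, hd⟩ := H k g (ε / 2) hk hg (half_pos hε)
    refine ⟨m, hm, lt_of_le_of_lt ?_ (half_lt_self hε)⟩
    refine Metric.diam_le_of_forall_dist_le (half_pos hε).le ?_
    rintro _ ⟨x, hx, rfl⟩ _ ⟨y, hy, rfl⟩
    exact (hd x hx y hy).le

/-- A function whose oscillation is controlled by that of two geometrically slowly oscillating
functions is geometrically slowly oscillating. -/
theorem GeometricallySlowlyOscillating.of_dist_le {X : Type u} [MetricSpace X] {f g F : X →ᵇ ℂ}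
    (hf : GeometricallySlowlyOscillating f) (hg : GeometricallySlowlyOscillating g) (C : ℝ)
    (hC : 0 ≤ C)
    (h : ∀ x y, dist (F x) (F y) ≤ C * (dist (f x) (f y) + dist (g x) (g y))) :
    GeometricallySlowlyOscillating F := by
  rw [geometricallySlowlyOscillating_iff] at hf hg ⊢
  refine ⟨fun x y M hx hxy => ?_, fun k c ε hk hc hε => ?_⟩
  · refine squeeze_zero (fun n => dist_nonneg) (fun n => h (x n) (y n)) ?_
    simpa using ((hf.1 x y M hx hxy).add (hg.1 x y M hx hxy)).const_mul C
  · have hpos : 0 < ε / (2 * (C + 1)) := by positivity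
    obtain ⟨m, hm, h1⟩ := hf.2 k c _ hk hc hpos
    obtain ⟨n, hn, h2⟩ := hg.2 k c _ hk hc hpos
    refine ⟨max m n, hm.trans (le_max_left _ _), fun x hx y hy => ?_⟩
    have a := h1 x (quasiGeodesicCone_anti _ _ _ (le_max_left m n) hx) y
      (quasiGeodesicCone_anti _ _ _ (le_max_left m n) hy)
    have b := h2 x (quasiGeodesicCone_anti _ _ _ (le_max_right m n) hx) y
      (quasiGeodesicCone_anti _ _ _ (le_max_right m n) hy)
    have e : (C + 1) * (ε / (2 * (C + 1)) + ε / (2 * (C + 1))) = ε := by field_simp; ring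
    calc dist (F x) (F y) ≤ C * (dist (f x) (f y) + dist (g x) (g y)) := h x y
      _ ≤ (C + 1) * (dist (f x) (f y) + dist (g x) (g y)) := by
          gcongr
          linarith
      _ < (C + 1) * (ε / (2 * (C + 1)) + ε / (2 * (C + 1))) := by gcongr
      _ = ε := e

theorem geometricallySlowlyOscillating_algebraMap {X : Type u} [MetricSpace X] (z : ℂ) :
    GeometricallySlowlyOscillating (algebraMap ℂ (X →ᵇ ℂ) z) := by
  rw [geometricallySlowlyOscillating_iff]
  exact ⟨fun x y M _ _ => by simp, fun k c ε _ _ hε => ⟨1, le_rfl, fun x _ y _ => by simpa⟩⟩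

/-- The algebra `C_QG(X)` of all geometrically slowly oscillating functions on `X`, with the
supremum norm. -/
noncomputable def slowlyOscillatingAlgebra (X : Type u) [MetricSpace X] :
    StarSubalgebra ℂ (X →ᵇ ℂ) where
  carrier := {f | GeometricallySlowlyOscillating f}
  add_mem' {f g} hf hg := hf.of_dist_le hg 1 zero_le_one fun x y => by
    simpa using dist_add_add_le (f x) (g x) (f y) (g y)
  mul_mem' {f g} hf hg := hf.of_dist_le hg (‖f‖ + ‖g‖) (by positivity) fun x y => by
    have e : f x * g x - f y * g y = f x * (g x - g y) + (f x - f y) * g y := by ring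
    have hfx := f.norm_coe_le_norm x
    have hgy := g.norm_coe_le_norm y
    simp only [BoundedContinuousFunction.coe_mul, Pi.mul_apply, dist_eq_norm]
    rw [e]
    refine (norm_add_le _ _).trans ?_
    rw [norm_mul, norm_mul]
    nlinarith [norm_nonneg f, norm_nonneg g, norm_nonneg (f x - f y), norm_nonneg (g x - g y),
      mul_le_mul_of_nonneg_right hfx (norm_nonneg (g x - g y)),
      mul_le_mul_of_nonneg_left hgy (norm_nonneg (f x - f y)),
      mul_nonneg (norm_nonneg f) (norm_nonneg (f x - f y)),
      mul_nonneg (norm_nonneg g) (norm_nonneg (g x - g y))]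
  algebraMap_mem' z := geometricallySlowlyOscillating_algebraMap z
  star_mem' {f} hf := hf.of_dist_le hf 1 zero_le_one fun x y => by
    have : dist (star f x) (star f y) = dist (f x) (f y) := by
      simp only [BoundedContinuousFunction.star_apply, dist_eq_norm, ← star_sub, norm_star]
    rw [this]
    linarith [dist_nonneg (x := f x) (y := f y)]

/-! ### The quasi-geodesic compactification -/

/-- The quasi-geodesic compactification `X_QG`: the maximal ideal space (space of characters with
the Gelfand topology) of the algebra `C_QG(X)`. -/
abbrev QGCompactification (X : Type u) [MetricSpace X] : Type u :=
  WeakDual.characterSpace ℂ (slowlyOscillatingAlgebra X)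

/-- The canonical map `X → X_QG`, sending a point to the evaluation of functions at it. -/
noncomputable def QGCompactification.ofPoint {X : Type u} [MetricSpace X] (x : X) :
    QGCompactification X :=
  ⟨StrongDual.toWeakDual ((BoundedContinuousFunction.evalCLM ℂ x).comp
      (slowlyOscillatingAlgebra X).toSubalgebra.toSubmodule.subtypeL),
    by
      refine ⟨fun h => ?_, fun f g => rfl⟩
      have := DFunLike.congr_fun h (1 : slowlyOscillatingAlgebra X)
      exact one_ne_zero (α := ℂ) this⟩

/-- The canonical map is evaluation. -/
theorem QGCompactification.ofPoint_apply {X : Type u} [MetricSpace X] (x : X)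
    (f : slowlyOscillatingAlgebra X) :
    QGCompactification.ofPoint x f = (f : X →ᵇ ℂ) x := rfl

/-- The quasi-geodesic boundary (corona) `X_QG ∖ X`. -/
def QGCompactification.corona (X : Type u) [MetricSpace X] : Set (QGCompactification X) :=
  (Set.range QGCompactification.ofPoint)ᶜ

/-! A function `f` in `C_QG(X)` has a limit along every geodesic ray, and `F` sends the class of a
ray to the character given by these limits. Everything rests on one construction
(`IsGeodesicSpace.mem_quasiGeodesicCone`): if the projection of `x` to the sphere of radius `m` is
within 1 of `c m`, then following the ray `c` and switching at time `m` to a geodesic towards `x`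
gives a (1,1)-quasi-geodesic. So `x` lies in the `m`-cone of `c`, and for suitable `m` all values of
`f` on the points of X in U(c, m, 1) are close to `f (c m)`. This yields the limits along rays and
the continuity of `F` at boundary points. Asymptotic rays give equal limits because `f` is slowly
oscillating.

For surjectivity, each character is a limit of evaluations along an ultrafilter on X. By properness
the ultrafilter either converges in X, or it leaves all bounded sets and its radial projections
converge to a ray; the same estimate then identifies the character with the limit along that ray.
Bump functions show that limits along rays are not evaluations, so the boundary maps exactly onto
the corona.

The CAT(0) inequality serves only to represent each boundary point by a ray from `x₀`. -/

/-! ### Radial projections and limit rays -/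

/-- A family of radial projections onto the balls about `x₀`, along chosen geodesics. -/
theorem IsGeodesicSpace.exists_radialProjection {X : Type u} [MetricSpace X]
    (hX : IsGeodesicSpace X) (x₀ : X) :
    ∃ p : ℝ≥0 → X → X, (∀ x, p 0 x = x₀) ∧ (∀ t x, dist x₀ (p t x) ≤ t) ∧
      (∀ (s t : ℝ≥0) x, (s : ℝ) ≤ dist x₀ x → (t : ℝ) ≤ dist x₀ x → dist (p s x) (p t x) = dist s t) ∧
      (∀ (t : ℝ≥0) x, (t : ℝ) ≤ dist x₀ x → dist x₀ (p t x) = t ∧ OnGeodesic x₀ x (p t x)) := by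
  choose γ h0 h1 hγ using hX x₀
  -- The parameter is clamped at `dist x₀ x`, so the projection is total and stays in the ball of
  -- radius `t`, as compactness requires later.
  have hmem : ∀ (t : ℝ≥0) x, min (t : ℝ) (dist x₀ x) ∈ Set.Icc 0 (dist x₀ x) := fun t x =>
    ⟨le_min t.2 dist_nonneg, min_le_right _ _⟩
  have hd : ∀ (t : ℝ≥0) x, dist x₀ (γ x (min (t : ℝ) (dist x₀ x))) = min (t : ℝ) (dist x₀ x) := by
    intro t x
    have := hγ x 0 ⟨le_rfl, dist_nonneg⟩ _ (hmem t x)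
    rwa [h0, zero_sub, abs_neg, abs_of_nonneg (hmem t x).1] at this
  refine ⟨fun t x => γ x (min (t : ℝ) (dist x₀ x)), fun x => ?_, fun t x => ?_,
    fun s t x hs ht => ?_, fun t x ht => ⟨?_, ?_⟩⟩
  · simp [h0]
  · rw [hd]
    exact min_le_left _ _
  · rw [hγ x _ (hmem s x) _ (hmem t x), min_eq_left hs, min_eq_left ht]
    rfl
  · rw [hd, min_eq_left ht]
  · have := hγ x _ (hmem t x) _ ⟨dist_nonneg, le_rfl⟩
    rw [h1, min_eq_left ht, abs_sub_comm, abs_of_nonneg (sub_nonneg.2 ht)] at this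
    have h2 := hd t x
    rw [min_eq_left ht] at h2
    simp only [OnGeodesic, min_eq_left ht]
    rw [this, h2]
    ring

/-- In a proper space, radial projections converge to a geodesic ray along every ultrafilter that
leaves all bounded sets. -/
theorem exists_geodesicRay_tendsto {X : Type u} [MetricSpace X] [ProperSpace X] {x₀ : X}
    {p : ℝ≥0 → X → X} (hp0 : ∀ x, p 0 x = x₀) (hp : ∀ t x, dist x₀ (p t x) ≤ t)
    (hpp : ∀ (s t : ℝ≥0) x, (s : ℝ) ≤ dist x₀ x → (t : ℝ) ≤ dist x₀ x → dist (p s x) (p t x) = dist s t)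
    (l : Ultrafilter X) (hl : (l : Filter X) ≤ cobounded X) :
    ∃ c : GeodesicRay X, c 0 = x₀ ∧ ∀ t, Tendsto (p t) l (𝓝 (c t)) := by
  have hlim : ∀ t, ∃ y, Tendsto (p t) l (𝓝 y) := by
    intro t
    obtain ⟨y, -, hy⟩ := (isCompact_closedBall x₀ (t : ℝ)).ultrafilter_le_nhds (l.map (p t)) (by
      simp only [le_principal_iff, Ultrafilter.mem_coe, Ultrafilter.mem_map]
      refine Filter.univ_mem' fun x => ?_
      simpa [dist_comm] using hp t x)
    exact ⟨y, hy⟩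
  choose c hc using hlim
  have hfar : ∀ t : ℝ≥0, ∀ᶠ x in (l : Filter X), (t : ℝ) ≤ dist x₀ x := fun t => by
    have := (Metric.tendsto_dist_left_cobounded_atTop x₀).mono_left hl
    exact this.eventually_ge_atTop _
  refine ⟨⟨c, Isometry.of_dist_eq fun s t => ?_⟩, ?_, hc⟩
  · refine tendsto_nhds_unique ((hc s).dist (hc t)) (tendsto_const_nhds.congr' ?_)
    filter_upwards [hfar s, hfar t] with x hs ht
    exact (hpp s t x hs ht).symm
  · refine tendsto_nhds_unique (hc 0) (tendsto_const_nhds.congr' ?_)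
    filter_upwards with x
    exact (hp0 x).symm

theorem GeodesicRay.tendsto_cobounded {X : Type u} [MetricSpace X] (c : GeodesicRay X) :
    Tendsto c atTop (cobounded X) := by
  rw [← Metric.comap_dist_left_atTop (c 0), tendsto_comap_iff]
  refine NNReal.tendsto_coe_atTop.2 tendsto_id |>.congr fun t => ?_
  have : dist (c 0) (c t) = |((0 : ℝ≥0) : ℝ) - t| := c.isometry.dist_eq 0 t
  simp [this]

/-! ### CAT(0) comparison and rays from the base point -/

/-- Every triple of numbers satisfying the triangle inequalities is realized in the plane. -/
theorem exists_euclidean_triangle {a b d : ℝ} (ha : 0 < a) (hb : 0 ≤ b) (hd : 0 ≤ d)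
    (h1 : a ≤ b + d) (h2 : b ≤ a + d) (h3 : d ≤ a + b) :
    ∃ q r : EuclideanSpace ℝ (Fin 2), ‖q‖ = a ∧ ‖r‖ = b ∧ dist q r = d := by
  -- With one vertex at the origin and `q` on the first axis, the law of cosines forces this first
  -- coordinate of `r`.
  set u := (a ^ 2 + b ^ 2 - d ^ 2) / (2 * a) with hu
  have hu' : 2 * a * u = a ^ 2 + b ^ 2 - d ^ 2 := by rw [hu]; field_simp
  have hub : 0 ≤ b ^ 2 - u ^ 2 := by
    -- Heron's factorization; each factor is nonnegative by a triangle inequality.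
    have e : (2 * a) ^ 2 * (b ^ 2 - u ^ 2) =
        ((a + b + d) * (a + b - d)) * ((b + d - a) * (a + d - b)) := by
      linear_combination (-(2 * a * u) - (a ^ 2 + b ^ 2 - d ^ 2)) * hu'
    have : 0 ≤ (2 * a) ^ 2 * (b ^ 2 - u ^ 2) := by
      rw [e]
      exact mul_nonneg (mul_nonneg (by linarith) (by linarith))
        (mul_nonneg (by linarith) (by linarith))
    exact nonneg_of_mul_nonneg_right this (by positivity)
  refine ⟨!₂[a, 0], !₂[u, √(b ^ 2 - u ^ 2)], ?_, ?_, ?_⟩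
  · simp [EuclideanSpace.norm_eq, Real.sqrt_sq_eq_abs, abs_of_pos ha]
  · simp [EuclideanSpace.norm_eq, Real.sq_sqrt hub, Real.sqrt_sq_eq_abs, abs_of_nonneg hb]
  · have e : (a - u) ^ 2 + (b ^ 2 - u ^ 2) = d ^ 2 := by linear_combination -hu'
    simp [EuclideanSpace.dist_eq, Real.dist_eq, Real.sq_sqrt hub, e, Real.sqrt_sq_eq_abs,
      abs_of_nonneg hd]

/-- Convexity of the metric: points dividing two sides of a triangle in the same ratio. -/
theorem IsCAT0Space.dist_le_of_ratio {X : Type u} [MetricSpace X] (hX : IsCAT0Space X)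
    {p q r x y : X} {a : ℝ} (ha0 : 0 ≤ a) (ha1 : a ≤ 1) (hpq : p ≠ q)
    (hx : dist p x = a * dist p q) (hx' : dist x q = (1 - a) * dist p q)
    (hy : dist p y = a * dist p r) (hy' : dist y r = (1 - a) * dist p r) :
    dist x y ≤ dist q r := by
  obtain ⟨q', r', hq, hr, hqr⟩ := exists_euclidean_triangle (dist_pos.2 hpq)
    (dist_nonneg (x := p) (y := r)) (dist_nonneg (x := q) (y := r))
    (by linarith [dist_triangle p r q, dist_comm r q]) (dist_triangle p q r)
    (by linarith [dist_triangle q p r, dist_comm p q])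
  have hs : ∀ v : EuclideanSpace ℝ (Fin 2), dist (a • v) v = (1 - a) * ‖v‖ := fun v => by
    have : a • v - v = (a - 1) • v := by module
    rw [dist_eq_norm, this, norm_smul, Real.norm_eq_abs, abs_sub_comm,
      abs_of_nonneg (by linarith)]
  -- In the comparison triangle with apex 0 the comparison points are `a • q'` and `a • r'`, whose
  -- distance is `a * dist q r`.
  have := hX.thin p q r x y 0 q' r' (a • q') (a • r') (by rw [OnGeodesic, hx, hx']; ring)
    (by rw [OnGeodesic, hy, hy']; ring) (by simpa) (by simpa) hqr
    (by simp [norm_smul, hx, hq, abs_of_nonneg ha0]) (by rw [hs, hx', hq])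
    (by simp [norm_smul, hy, hr, abs_of_nonneg ha0]) (by rw [hs, hy', hr])
  refine this.trans ?_
  rw [dist_smul₀, hqr, Real.norm_eq_abs, abs_of_nonneg ha0]
  exact mul_le_of_le_one_left dist_nonneg ha1

theorem GeodesicRay.dist_apply {X : Type u} [MetricSpace X] (c : GeodesicRay X) (s t : ℝ≥0) :
    dist (c s) (c t) = |(s : ℝ) - t| := c.isometry.dist_eq s t

/-- The geodesic from `x₀` to a far point of a ray stays close to the ray. -/
theorem IsCAT0Space.dist_ray_le {X : Type u} [MetricSpace X] (hX : IsCAT0Space X) {x₀ y : X}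
    (c : GeodesicRay X) {n t : ℝ≥0} (hn : dist x₀ (c 0) < n) (ht : (t : ℝ) ≤ dist x₀ (c n))
    (hy : dist x₀ y = t) (hyn : OnGeodesic x₀ (c n) y) :
    dist y (c t) ≤ 2 * dist x₀ (c 0) := by
  set D := dist x₀ (c 0) with hD
  set L := dist x₀ (c n) with hL
  have hD0 : 0 ≤ D := dist_nonneg
  have h0n : dist (c 0) (c n) = n := by simp [c.dist_apply]
  have hLn : |(n : ℝ) - L| ≤ D := by
    rw [abs_le]
    constructor
    · linarith [dist_triangle x₀ (c 0) (c n)]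
    · linarith [dist_triangle (c 0) x₀ (c n), dist_comm x₀ (c 0)]
  have hLpos : 0 < L := by linarith [(abs_le.1 hLn).2]
  -- Seen from the apex `c n`, the point `c s` divides the side to `c 0` in the ratio in which `y`
  -- divides the side to `x₀`. Convexity bounds `dist (c s) y` by `D`, and `|s - t| = (t / L) * |n -
  -- L| ≤ D` accounts for the second `D`.
  set s : ℝ≥0 := n * t / nndist x₀ (c n) with hs
  have hsv : (s : ℝ) = n * t / L := by rw [hs, NNReal.coe_div, NNReal.coe_mul, coe_nndist]
  have hsn : (s : ℝ) ≤ n := by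
    rw [hsv, div_le_iff₀ hLpos]
    exact mul_le_mul_of_nonneg_left ht n.2
  have hr : (t : ℝ) / L ≤ 1 := (div_le_one hLpos).2 ht
  have ht0 : (0 : ℝ) ≤ t / L := div_nonneg t.2 hLpos.le
  have hyn' : dist y (c n) = L - t := by
    have : dist x₀ y + dist y (c n) = L := hyn
    linarith
  have hne : c n ≠ c 0 := by
    intro h
    rw [h, dist_self] at h0n
    linarith
  have key : dist (c s) y ≤ dist (c 0) x₀ := by
    refine hX.dist_le_of_ratio (p := c n) (a := 1 - t / L) (by linarith) (by linarith) hne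
      ?_ ?_ ?_ ?_
    · rw [dist_comm (c n) (c 0), h0n, c.dist_apply, abs_of_nonneg (by linarith), hsv]
      ring
    · rw [dist_comm (c n) (c 0), h0n, c.dist_apply, hsv]
      simp only [NNReal.coe_zero, sub_zero]
      rw [abs_of_nonneg (by positivity)]
      ring
    · rw [dist_comm, hyn', dist_comm, ← hL]
      field_simp
    · rw [dist_comm y, hy, dist_comm (c n), ← hL]
      field_simp
      ring
  have hst : dist (c s) (c t) ≤ D := by
    have e : (s : ℝ) - t = t / L * (n - L) := by rw [hsv]; field_simp
    rw [c.dist_apply, e, abs_mul, abs_of_nonneg ht0]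
    calc t / L * |(n : ℝ) - L| ≤ 1 * D := by gcongr
      _ = D := one_mul D
  linarith [dist_triangle y (c s) (c t), dist_comm y (c s), dist_comm (c 0) x₀]

/-- Every boundary point is represented by a ray issuing from `x₀`. -/
theorem IsCAT0Space.exists_ray_endpoint_eq {X : Type u} [MetricSpace X] [ProperSpace X]
    (hX : IsCAT0Space X) (x₀ : X) (ξ : VisualBoundary X) :
    ∃ c : GeodesicRay X, c 0 = x₀ ∧ c.endpoint = ξ := by
  obtain ⟨c, rfl⟩ := Quotient.exists_rep ξ
  obtain ⟨p, hp0, hp, hpp, hpg⟩ := hX.geodesic.exists_radialProjection x₀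
  set l : Ultrafilter ℝ≥0 := Ultrafilter.of atTop
  have hl : Tendsto c l (cobounded X) := c.tendsto_cobounded.mono_left (Ultrafilter.of_le _)
  obtain ⟨c', h0, hc'⟩ := exists_geodesicRay_tendsto hp0 hp hpp (l.map c) hl
  refine ⟨c', h0, Quotient.sound ⟨2 * dist x₀ (c 0), fun t => ?_⟩⟩
  have h1 : Tendsto (fun n => dist (p t (c n)) (c t)) l (𝓝 (dist (c' t) (c t))) :=
    Tendsto.dist ((hc' t).comp tendsto_map) tendsto_const_nhds
  refine le_of_tendsto h1 ?_
  have h2 := ((Metric.tendsto_dist_left_cobounded_atTop x₀).comp hl).eventually_ge_atTop (t : ℝ)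
  have h3 : ∀ᶠ n : ℝ≥0 in l, dist x₀ (c 0) < n := by
    filter_upwards [Ultrafilter.of_le _ (eventually_gt_atTop (nndist x₀ (c 0)))]
      with n hn using hn
  filter_upwards [h2, h3] with n hn hn'
  exact hX.dist_ray_le c hn' hn (hpg t _ hn).1 (hpg t _ hn).2

/-! ### Quasi-geodesics that follow a ray, and oscillation near the boundary -/

open VisualCompactification in
theorem isProjection_ray {X : Type u} [MetricSpace X] {x₀ : X} {c : GeodesicRay X} (hc : c 0 = x₀)
    {r t : ℝ≥0} (h : r < t) : IsProjection (x₀ := x₀) r (point (c t)) (c r) := by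
  have h' : (r : ℝ) < t := h
  subst hc
  refine ⟨?_, ?_, ?_⟩
  · simpa [c.dist_apply] using h'
  · simp [c.dist_apply]
  · simp only [OnGeodesic, c.dist_apply, NNReal.coe_zero, zero_sub, abs_neg, NNReal.abs_eq]
    rw [abs_sub_comm, abs_of_nonneg (by linarith)]
    ring

open VisualCompactification in
/-- Following a ray up to time `m` and then a geodesic to a point `x` whose projection to the
sphere of radius `m` is close to the ray gives a quasi-geodesic. -/
theorem IsGeodesicSpace.mem_quasiGeodesicCone {X : Type u} [MetricSpace X]
    (hX : IsGeodesicSpace X) {x₀ : X} {c : GeodesicRay X} (hc : c 0 = x₀) {m : ℕ}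
    {x y : X} (hxy : IsProjection (x₀ := x₀) (m : ℝ≥0) (point x) y) (hy : dist y (c m) < 1) :
    x ∈ quasiGeodesicCone 1 1 (fun i => c ((i - 1 : ℕ) : ℝ≥0)) m := by
  obtain ⟨hd, hym, hon⟩ := hxy
  set d := dist x₀ x with hdef
  simp only [NNReal.coe_natCast] at hd hym
  have hyx : dist y x = d - m := by
    have : dist x₀ y + dist y x = d := hon
    linarith
  obtain ⟨γ, h0, h1, hγ⟩ := hX y x
  rw [hyx] at h1 hγ
  -- `τ i` is the intended distance of `h i` from `x₀`. Indices start at 1, so `h` is on the ray up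
  -- to `c (m - 1)` and `h (m + 1) = y`; the path from `c m` to `y` costs less than 1, which the
  -- additive constant absorbs.
  set τ : ℕ → ℝ := fun i => min ((i : ℝ) - 1) d with hτ
  set h : ℕ → X := fun i => if i ≤ m then c ((i - 1 : ℕ) : ℝ≥0) else γ (τ i - m) with hh
  have hle : ∀ i, i ≤ m → h i = c ((i - 1 : ℕ) : ℝ≥0) := fun i hi => if_pos hi
  have hgt : ∀ i, m < i → h i = γ (τ i - m) := fun i hi => if_neg (not_le.2 hi)
  have hτle : ∀ i, i ≤ m → τ i = (i : ℝ) - 1 := fun i hi => by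
    have : (i : ℝ) ≤ m := by exact_mod_cast hi
    exact min_eq_left (by linarith)
  have hτgt : ∀ i, m < i → τ i - m ∈ Set.Icc 0 (d - m) := fun i hi => by
    have : (m : ℝ) + 1 ≤ i := by exact_mod_cast hi
    exact ⟨sub_nonneg.2 (le_min (by linarith) hd.le), sub_le_sub_right (min_le_right _ _) _⟩
  have hsub : ∀ i : ℕ, 1 ≤ i → ((i - 1 : ℕ) : ℝ) = i - 1 := fun i hi => by
    rw [Nat.cast_sub hi, Nat.cast_one]
  have hcast : ∀ i : ℕ, 1 ≤ i → (((i - 1 : ℕ) : ℝ≥0) : ℝ) = i - 1 := fun i hi => by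
    rw [NNReal.coe_natCast, hsub i hi]
  -- Beyond `m`, going through `y` bounds the radius above, and `dist x₀ x = d` bounds it below.
  have hrad : ∀ i, 1 ≤ i → dist x₀ (h i) = τ i := by
    intro i hi
    rcases le_or_gt i m with him | him
    · have h1i : (1 : ℝ) ≤ i := by exact_mod_cast hi
      rw [hle i him, hτle i him, ← hc, c.dist_apply, hcast i hi, NNReal.coe_zero, zero_sub,
        abs_neg, abs_of_nonneg (by linarith)]
    · rw [hgt i him]
      have hm' := hτgt i him
      have a := hγ 0 ⟨le_rfl, by linarith⟩ _ hm'
      have b := hγ _ hm' (d - m) ⟨by linarith, le_rfl⟩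
      rw [h0, zero_sub, abs_neg, abs_of_nonneg hm'.1] at a
      rw [h1, abs_sub_comm, abs_of_nonneg (by linarith [hm'.2])] at b
      linarith [dist_triangle x₀ y (γ (τ i - m)), dist_triangle x₀ (γ (τ i - m)) x]
  have hupper : ∀ i j, 1 ≤ i → i ≤ j → dist (h i) (h j) ≤ (j : ℝ) - i + 1 := by
    intro i j hi hij
    have hij' : (i : ℝ) ≤ j := by exact_mod_cast hij
    have hτj : τ j ≤ j - 1 := min_le_left _ _
    rcases le_or_gt j m with hjm | hjm
    · rw [hle i (hij.trans hjm), hle j hjm, c.dist_apply, hcast i hi, hcast j (hi.trans hij),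
        abs_sub_comm, abs_of_nonneg (by linarith)]
      linarith
    have hj := hτgt j hjm
    rcases le_or_gt i m with him | him
    · have him' : (i : ℝ) ≤ m := by exact_mod_cast him
      have a := hγ 0 ⟨le_rfl, by linarith⟩ _ hj
      rw [h0, zero_sub, abs_neg, abs_of_nonneg hj.1, ← hgt j hjm] at a
      have b : dist (h i) (c m) = m - (i - 1) := by
        rw [hle i him, c.dist_apply, hcast i hi, NNReal.coe_natCast, abs_sub_comm,
          abs_of_nonneg (by linarith)]
      linarith [dist_triangle4 (h i) (c m) y (h j), dist_comm y (c m)]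
    · rw [hgt i him, hgt j hjm, hγ _ (hτgt i him) _ hj]
      have e : τ i - m - (τ j - m) = min ((i : ℝ) - 1) d - min ((j : ℝ) - 1) d := by
        simp only [hτ]; ring
      rw [e]
      refine (abs_min_sub_min_le_max _ _ _ _).trans ?_
      rw [sub_self, abs_zero, max_eq_left (abs_nonneg _), abs_sub_comm,
        abs_of_nonneg (by linarith)]
      linarith
  -- The least index guaranteed to reach `x`: `τ N = d`, while the clamping costs at most 1, so `τ j
  -- ≥ j - 2` for `j ≤ N`. The lower bound follows from the difference of radii.
  set N : ℕ := ⌈d⌉₊ + 1 with hN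
  have hdN : d ≤ (N : ℝ) - 1 := by
    rw [hN]; push_cast
    linarith [Nat.le_ceil d]
  have hNd : (N : ℝ) - 1 < d + 1 := by
    rw [hN]; push_cast
    linarith [Nat.ceil_lt_add_one (dist_nonneg : 0 ≤ d)]
  have hmN : m < N := by
    have : (m : ℝ) < N := by linarith
    exact_mod_cast this
  have hlower : ∀ i j, 1 ≤ i → i ≤ j → j ≤ N → (j : ℝ) - i - 1 ≤ dist (h i) (h j) := by
    intro i j hi hij hjN
    have hij' : (i : ℝ) ≤ j := by exact_mod_cast hij
    have hjN' : (j : ℝ) ≤ N := by exact_mod_cast hjN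
    have a : τ i ≤ i - 1 := min_le_left _ _
    have b : (j : ℝ) - 2 ≤ τ j := le_min (by linarith) (by linarith)
    have e1 := hrad i hi
    have e2 := hrad j (hi.trans hij)
    linarith [dist_triangle x₀ (h i) (h j)]
  refine ⟨N, h, ?_, fun i _ him => hle i him, N, ⟨by omega, le_rfl⟩, hmN.le, ?_⟩
  · have main : ∀ i j, 1 ≤ i → i ≤ j → j ≤ N → |(i : ℝ) - j| / 1 - 1 ≤ dist (h i) (h j) ∧
        dist (h i) (h j) ≤ 1 * |(i : ℝ) - j| + 1 := by
      intro i j hi hij hjN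
      have hij' : (i : ℝ) ≤ j := by exact_mod_cast hij
      rw [abs_sub_comm, abs_of_nonneg (by linarith), div_one, one_mul]
      exact ⟨hlower i j hi hij hjN, hupper i j hi hij⟩
    rintro i ⟨hi, hiN⟩ j ⟨hj, hjN⟩
    rcases le_total i j with hij | hij
    · exact main i j hi hij (by exact_mod_cast hjN)
    · rw [dist_comm, abs_sub_comm]
      exact main j i hj hij (by exact_mod_cast hiN)
  · rw [hgt N hmN, ← h1]
    simp only [hτ]
    rw [min_eq_right hdN]

theorem GeodesicRay.isIntegralQuasiGeodesicRay {X : Type u} [MetricSpace X] (c : GeodesicRay X) :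
    IsIntegralQuasiGeodesicRay 1 1 (fun i => c ((i - 1 : ℕ) : ℝ≥0)) := by
  rintro i ⟨hi, -⟩ j ⟨hj, -⟩
  have e : dist (c ((i - 1 : ℕ) : ℝ≥0)) (c ((j - 1 : ℕ) : ℝ≥0)) = |(i : ℝ) - j| := by
    rw [c.dist_apply, NNReal.coe_natCast, NNReal.coe_natCast, Nat.cast_sub hi, Nat.cast_sub hj]
    simp
  simp only [e]
  constructor <;> linarith

open VisualCompactification in
/-- A geometrically slowly oscillating function varies little on basic neighbourhoods of a
boundary point. -/
theorem GeometricallySlowlyOscillating.exists_forall_dist_lt {X : Type u} [MetricSpace X]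
    (hX : IsGeodesicSpace X) {f : X →ᵇ ℂ} (hf : GeometricallySlowlyOscillating f) {x₀ : X}
    {c : GeodesicRay X} (hc : c 0 = x₀) {ε : ℝ} (hε : 0 < ε) :
    ∃ m : ℕ, 1 ≤ m ∧ ∀ x y, IsProjection (x₀ := x₀) (m : ℝ≥0) (point x) y → dist y (c m) < 1 →
      dist (f x) (f (c m)) < ε := by
  rw [geometricallySlowlyOscillating_iff] at hf
  obtain ⟨m, hm, H⟩ := hf.2 1 _ ε le_rfl c.isIntegralQuasiGeodesicRay hε
  refine ⟨m, hm, fun x y hxy hy => H x (hX.mem_quasiGeodesicCone hc hxy hy) _ ?_⟩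
  -- Because of the index shift, `c m` is the value of the sampled ray at `m + 1`.
  exact ⟨⊤, _, c.isIntegralQuasiGeodesicRay, fun _ _ _ => rfl, m + 1, ⟨by omega, le_top⟩,
    by omega, by simp⟩

/-- The points `c t` with `t > m` project exactly to `c m`, so the oscillation estimate is the
Cauchy criterion. -/
theorem GeometricallySlowlyOscillating.exists_tendsto_ray {X : Type u} [MetricSpace X]
    (hX : IsGeodesicSpace X) {f : X →ᵇ ℂ} (hf : GeometricallySlowlyOscillating f)
    (c : GeodesicRay X) : ∃ z, Tendsto (fun t => f (c t)) atTop (𝓝 z) := by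
  refine cauchySeq_tendsto_of_complete (Metric.cauchySeq_iff'.2 fun ε hε => ?_)
  obtain ⟨m, -, H⟩ := hf.exists_forall_dist_lt hX (c := c) rfl hε
  refine ⟨m, fun t ht => ?_⟩
  rcases ht.eq_or_lt with rfl | ht
  · simpa
  · exact H _ _ (isProjection_ray rfl ht) (by simp)

/-! ### Characters of `C_QG(X)` as limits of evaluations -/

namespace QGCompactification

/-- A pointwise limit of evaluations is a character. -/
theorem exists_tendsto_apply {X : Type u} [MetricSpace X] {ι : Type*} {l : Filter ι} [l.NeBot]
    (v : ι → X)
    (h : ∀ f : slowlyOscillatingAlgebra X, ∃ z, Tendsto (fun i => (f : X →ᵇ ℂ) (v i)) l (𝓝 z)) :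
    ∃ φ : QGCompactification X, ∀ f : slowlyOscillatingAlgebra X,
      Tendsto (fun i => (f : X →ᵇ ℂ) (v i)) l (𝓝 (φ f)) := by
  choose L hL using h
  let Φ : slowlyOscillatingAlgebra X →ₗ[ℂ] ℂ :=
    { toFun := L
      map_add' := fun f g => tendsto_nhds_unique (hL (f + g)) ((hL f).add (hL g))
      map_smul' := fun a f => tendsto_nhds_unique (hL (a • f)) ((hL f).const_mul a) }
  have hΦ : ∀ f, ‖Φ f‖ ≤ 1 * ‖f‖ := fun f => by
    rw [one_mul]
    exact le_of_tendsto (hL f).norm (Eventually.of_forall fun i =>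
      (f : X →ᵇ ℂ).norm_coe_le_norm (v i))
  refine ⟨⟨StrongDual.toWeakDual (Φ.mkContinuous 1 hΦ), fun h => ?_, fun f g => ?_⟩, hL⟩
  · have h1 : L 1 = 0 := DFunLike.congr_fun h (1 : slowlyOscillatingAlgebra X)
    have h2 : Tendsto (fun _ : ι => (1 : ℂ)) l (𝓝 (L 1)) := hL 1
    rw [h1] at h2
    exact one_ne_zero (tendsto_nhds_unique tendsto_const_nhds h2)
  · exact tendsto_nhds_unique (hL (f * g)) ((hL f).mul (hL g))

/-- An element of `C_QG(X)` that is bounded away from zero is invertible. -/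
theorem exists_mul_eq_one {X : Type u} [MetricSpace X] (g : slowlyOscillatingAlgebra X) {δ : ℝ}
    (hδ : 0 < δ) (h : ∀ x, δ ≤ ‖(g : X →ᵇ ℂ) x‖) : ∃ g' : slowlyOscillatingAlgebra X, g * g' = 1 := by
  have hne : ∀ x, (g : X →ᵇ ℂ) x ≠ 0 := fun x => norm_pos_iff.1 (hδ.trans_le (h x))
  let G : X →ᵇ ℂ := BoundedContinuousFunction.ofNormedAddCommGroup (fun x => ((g : X →ᵇ ℂ) x)⁻¹)
    ((g : X →ᵇ ℂ).continuous.inv₀ hne) δ⁻¹ fun x => by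
      rw [norm_inv]
      exact inv_anti₀ hδ (h x)
  have hG : GeometricallySlowlyOscillating G := by
    refine g.2.of_dist_le g.2 (δ⁻¹ * δ⁻¹) (by positivity) fun x y => ?_
    change dist ((g : X →ᵇ ℂ) x)⁻¹ ((g : X →ᵇ ℂ) y)⁻¹ ≤ _
    rw [dist_inv_inv₀ (hne x) (hne y), div_eq_inv_mul, mul_inv]
    gcongr
    · exact h x
    · exact h y
    · linarith [dist_nonneg (x := (g : X →ᵇ ℂ) x) (y := (g : X →ᵇ ℂ) y)]
  refine ⟨⟨G, hG⟩, Subtype.ext (BoundedContinuousFunction.ext fun x => ?_)⟩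
  exact mul_inv_cancel₀ (hne x)

/-- `X` is dense in `X_QG`. -/
theorem exists_ultrafilter_tendsto {X : Type u} [MetricSpace X] (φ : QGCompactification X) :
    ∃ l : Ultrafilter X, ∀ f : slowlyOscillatingAlgebra X, Tendsto (f : X →ᵇ ℂ) l (𝓝 (φ f)) := by
  let K := {g : slowlyOscillatingAlgebra X // φ g = 0}
  -- An element of the kernel is not invertible, hence not bounded away from zero, so this filter of
  -- neighbourhoods of its approximate zeros is proper.
  let B : K → Filter X := fun g => comap ((g.1 : X →ᵇ ℂ) : X → ℂ) (𝓝 0)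
  have hne : ∀ g, (B g).NeBot := by
    rintro ⟨g, hg⟩
    rw [neBot_iff]
    intro hbot
    obtain ⟨s, hs, hs'⟩ := mem_comap.1 (empty_mem_iff_bot.2 hbot)
    obtain ⟨δ, hδ, hball⟩ := Metric.mem_nhds_iff.1 hs
    obtain ⟨g', hg'⟩ := exists_mul_eq_one g hδ fun x => by
      by_contra! hx
      exact hs' (hball (mem_ball_zero_iff.2 hx))
    have := congrArg φ hg'
    rw [map_mul, hg, zero_mul, map_one] at this
    exact zero_ne_one this
  have hdir : Directed (· ≥ ·) B := by
    rintro ⟨g₁, h₁⟩ ⟨g₂, h₂⟩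
    -- Where |g₁|² + |g₂|² is small, both functions are small; this makes the family directed.
    have hs : φ (star g₁ * g₁ + star g₂ * g₂) = 0 := by simp [h₁, h₂]
    have hv : ∀ x, ‖((star g₁ * g₁ + star g₂ * g₂ : slowlyOscillatingAlgebra X) : X →ᵇ ℂ) x‖ =
        ‖(g₁ : X →ᵇ ℂ) x‖ ^ 2 + ‖(g₂ : X →ᵇ ℂ) x‖ ^ 2 := fun x => by
      change ‖star ((g₁ : X →ᵇ ℂ) x) * (g₁ : X →ᵇ ℂ) x +
        star ((g₂ : X →ᵇ ℂ) x) * (g₂ : X →ᵇ ℂ) x‖ = _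
      simp only [RCLike.star_def, RCLike.conj_mul]
      norm_cast
      exact abs_of_nonneg (by positivity)
    have hlim : Tendsto (fun x => ‖(g₁ : X →ᵇ ℂ) x‖ ^ 2 + ‖(g₂ : X →ᵇ ℂ) x‖ ^ 2)
        (B ⟨_, hs⟩) (𝓝 0) := by
      have : Tendsto ((star g₁ * g₁ + star g₂ * g₂ : slowlyOscillatingAlgebra X) : X →ᵇ ℂ)
          (B ⟨_, hs⟩) (𝓝 0) := tendsto_comap
      simpa only [hv, norm_zero] using this.norm
    have hsq : ∀ u : X → ℂ, Tendsto (fun x => ‖u x‖ ^ 2) (B ⟨_, hs⟩) (𝓝 0) →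
        Tendsto u (B ⟨_, hs⟩) (𝓝 0) := fun u hu => by
      rw [tendsto_zero_iff_norm_tendsto_zero]
      simpa [Real.sqrt_sq] using hu.sqrt
    refine ⟨⟨_, hs⟩, tendsto_iff_comap.1 (hsq _ ?_), tendsto_iff_comap.1 (hsq _ ?_)⟩
    · exact squeeze_zero (fun x => by positivity) (fun x => by
        linarith [sq_nonneg ‖(g₂ : X →ᵇ ℂ) x‖]) hlim
    · exact squeeze_zero (fun x => by positivity) (fun x => by
        linarith [sq_nonneg ‖(g₁ : X →ᵇ ℂ) x‖]) hlim
  have : Nonempty K := ⟨⟨0, map_zero φ⟩⟩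
  have := iInf_neBot_of_directed' hdir hne
  refine ⟨Ultrafilter.of (⨅ g, B g), fun f => ?_⟩
  -- Subtracting its value at `φ` puts any `f` in the kernel, which reduces convergence to
  -- convergence to zero.
  have hf : φ (f - algebraMap ℂ _ (φ f)) = 0 := by
    rw [map_sub, AlgHomClass.commutes]
    simp
  have h0 : Tendsto ((f - algebraMap ℂ _ (φ f) : slowlyOscillatingAlgebra X) : X →ᵇ ℂ)
      (Ultrafilter.of (⨅ g, B g)) (𝓝 0) :=
    tendsto_iff_comap.2 ((Ultrafilter.of_le _).trans (iInf_le B ⟨_, hf⟩))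
  have h1 := h0.add_const (φ f)
  rw [zero_add] at h1
  refine h1.congr fun x => ?_
  change (f : X →ᵇ ℂ) x - (algebraMap ℂ (X →ᵇ ℂ) (φ f)) x + φ f = _
  simp

end QGCompactification

/-! ### Asymptotic rays and bump functions -/

/-- At integer times the two rays give sequences tending to infinity at bounded distance from each
other, to which slow oscillation applies directly. -/
theorem SlowlyOscillating.limit_eq_of_asymptotic {X : Type u} [MetricSpace X] {f : X → ℂ}
    (hf : SlowlyOscillating f) {c c' : GeodesicRay X} (h : c.endpoint = c'.endpoint) {z z' : ℂ}
    (hz : Tendsto (fun t => f (c t)) atTop (𝓝 z)) (hz' : Tendsto (fun t => f (c' t)) atTop (𝓝 z')) :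
    z = z' := by
  obtain ⟨K, hK⟩ : ∃ K : ℝ, ∀ t : ℝ≥0, dist (c t) (c' t) ≤ K := Quotient.exact h
  have hn : Tendsto (fun n : ℕ => (n : ℝ≥0)) atTop atTop := tendsto_natCast_atTop_atTop
  have h1 := hf (fun n => c n) (fun n => c' n) (K + 1) (c.tendsto_cobounded.comp hn)
    fun n => (hK n).trans_lt (lt_add_one K)
  exact dist_eq_zero.1 (tendsto_nhds_unique ((hz.comp hn).dist (hz'.comp hn)) h1)

/-- A function that vanishes outside a ball is geometrically slowly oscillating. -/
theorem geometricallySlowlyOscillating_of_eq_zero {X : Type u} [MetricSpace X] {f : X →ᵇ ℂ} (x : X)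
    (R : ℝ) (h : ∀ y, R ≤ dist x y → f y = 0) : GeometricallySlowlyOscillating f := by
  rw [geometricallySlowlyOscillating_iff]
  refine ⟨fun u v M hu huv => ?_, fun k g ε hk hg hε => ?_⟩
  · have hd := (Metric.tendsto_dist_left_cobounded_atTop x).comp hu
    refine tendsto_const_nhds.congr' ?_
    filter_upwards [hd.eventually_ge_atTop R, hd.eventually_ge_atTop (R + M)] with n h1 h2
    simp only [Function.comp_apply] at h1 h2
    rw [h _ h1, h _ (by linarith [dist_triangle x (v n) (u n), dist_comm (u n) (v n), huv n]),
      dist_self]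
  -- The lower quasi-geodesic bound `(i - 1) / k - k` from the common origin `g 1` puts every index
  -- past this threshold at distance at least `R` from `x`. Taking `max m 1` below ensures that the
  -- origin is indeed shared.
  · obtain ⟨m, hm⟩ := exists_nat_ge (k * (R + dist x (g 1) + k) + 1)
    have key : ∀ y ∈ quasiGeodesicCone k k g (max m 1), f y = 0 := by
      rintro y ⟨N, u, hu, hug, i, hi, hmi, rfl⟩
      refine h _ ?_
      have h1i : (1 : ℝ) ≤ i := by exact_mod_cast hi.1
      have hmi' : (m : ℝ) ≤ i := by exact_mod_cast (le_max_left m 1).trans hmi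
      have hlow := (hu 1 ⟨le_rfl, le_trans (by exact_mod_cast hi.1) hi.2⟩ i hi).1
      rw [hug 1 le_rfl (le_max_right m 1), abs_sub_comm, Nat.cast_one,
        abs_of_nonneg (by linarith)] at hlow
      have : R + dist x (g 1) + k ≤ ((i : ℝ) - 1) / k := by
        rw [le_div_iff₀ (by linarith)]
        linarith
      linarith [dist_triangle x (g 1) (u i), dist_triangle (g 1) x (u i), dist_comm x (g 1)]
    refine ⟨max m 1, le_max_right _ _, fun y hy z hz => ?_⟩
    rwa [key y hy, key z hz, dist_self]

/-- A function in `C_QG(X)` that is `1` at a given point and vanishes at infinity. -/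
theorem exists_bump {X : Type u} [MetricSpace X] (x : X) :
    ∃ f : slowlyOscillatingAlgebra X, (f : X →ᵇ ℂ) x = 1 ∧
      ∀ y, 1 ≤ dist x y → (f : X →ᵇ ℂ) y = 0 := by
  let f : X →ᵇ ℂ := BoundedContinuousFunction.ofNormedAddCommGroup
    (fun y => ((max 0 (1 - dist x y) : ℝ) : ℂ)) (by fun_prop) 1 fun y => by
      rw [Complex.norm_real, Real.norm_eq_abs, abs_of_nonneg (le_max_left _ _)]
      exact max_le zero_le_one (by linarith [dist_nonneg (x := x) (y := y)])
  have h0 : ∀ y, 1 ≤ dist x y → f y = 0 := fun y hy => by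
    change ((max 0 (1 - dist x y) : ℝ) : ℂ) = 0
    rw [max_eq_left (by linarith), Complex.ofReal_zero]
  refine ⟨⟨f, geometricallySlowlyOscillating_of_eq_zero x 1 h0⟩, ?_, h0⟩
  change ((max 0 (1 - dist x x) : ℝ) : ℂ) = 1
  simp

/-! ### The extension to the visual compactification and its continuity -/

namespace VisualCompactification

theorem isOpen_image_ball {X : Type u} [MetricSpace X] {x₀ : X} (x : X) (ρ : ℝ) :
    IsOpen (point '' Metric.ball x ρ : Set (VisualCompactification x₀)) :=
  TopologicalSpace.isOpen_generateFrom_of_mem (Or.inl ⟨x, ρ, rfl⟩)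

theorem isOpen_coneNhd {X : Type u} [MetricSpace X] {x₀ : X} {c : GeodesicRay X} (hc : c 0 = x₀)
    {r : ℝ≥0} (hr : 0 < r) {ε : ℝ} (hε : 0 < ε) :
    IsOpen (coneNhd c r ε : Set (VisualCompactification x₀)) :=
  TopologicalSpace.isOpen_generateFrom_of_mem (Or.inr ⟨c, r, ε, hc, hr, hε, rfl⟩)

/-- The evaluations at points of `X` extend to a map on the visual compactification, given on the
boundary by limits along rays. -/
theorem exists_extension {X : Type u} [MetricSpace X] [ProperSpace X] (hX : IsCAT0Space X)
    (x₀ : X) : ∃ F : VisualCompactification x₀ → QGCompactification X,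
      (∀ x, F (point x) = QGCompactification.ofPoint x) ∧
      ∀ c : GeodesicRay X, ∀ f : slowlyOscillatingAlgebra X,
        Tendsto (fun t => (f : X →ᵇ ℂ) (c t)) atTop (𝓝 (F (boundary c.endpoint) f)) := by
  have hlim := fun (c : GeodesicRay X) (f : slowlyOscillatingAlgebra X) =>
    GeometricallySlowlyOscillating.exists_tendsto_ray hX.geodesic f.2 c
  choose φ hφ using fun c : GeodesicRay X => QGCompactification.exists_tendsto_apply c (hlim c)
  -- The choice of representative is harmless: any ray in the class gives the same limits.
  choose c hc using hX.exists_ray_endpoint_eq x₀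
  refine ⟨fun | point x => QGCompactification.ofPoint x | boundary ξ => φ (c ξ), fun x => rfl,
    fun c' f => ?_⟩
  obtain ⟨z, hz⟩ := hlim c' f
  rwa [← SlowlyOscillating.limit_eq_of_asymptotic f.2.1 (hc c'.endpoint).2.symm hz (hφ _ f)]

/-- Near a boundary point, the set U(c, m, 1) works: interior points are handled by the oscillation
estimate, boundary points by passing to the limit along rays that satisfy it. -/
theorem continuous_of_tendsto_ray {X : Type u} [MetricSpace X] [ProperSpace X]
    (hX : IsCAT0Space X) {x₀ : X} {F : VisualCompactification x₀ → ℂ} {f : X →ᵇ ℂ}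
    (hf : GeometricallySlowlyOscillating f) (hp : ∀ x, F (point x) = f x)
    (hF : ∀ c : GeodesicRay X, Tendsto (fun t => f (c t)) atTop (𝓝 (F (boundary c.endpoint)))) :
    Continuous F := by
  rw [continuous_iff_continuousAt]
  rintro (x | ξ)
  · rw [ContinuousAt, Metric.tendsto_nhds]
    intro ε hε
    obtain ⟨δ, hδ, hball⟩ := Metric.continuousAt_iff.1 f.continuous.continuousAt ε hε
    filter_upwards [(isOpen_image_ball x δ).mem_nhds ⟨x, Metric.mem_ball_self hδ, rfl⟩]
    rintro _ ⟨y, hy, rfl⟩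
    rw [hp, hp]
    exact hball hy
  · obtain ⟨c, hc, rfl⟩ := hX.exists_ray_endpoint_eq x₀ ξ
    rw [ContinuousAt, Metric.tendsto_nhds]
    intro ε hε
    obtain ⟨m, hm, H⟩ := hf.exists_forall_dist_lt hX.geodesic hc (ε := ε / 3) (by positivity)
    have hray : ∀ c' : GeodesicRay X, c' 0 = x₀ → dist (c' m) (c m) < 1 →
        dist (F (boundary c'.endpoint)) (f (c m)) ≤ ε / 3 := by
      intro c' hc' hd
      refine le_of_tendsto ((hF c').dist tendsto_const_nhds) ?_
      filter_upwards [eventually_gt_atTop (m : ℝ≥0)] with t ht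
      exact (H _ _ (isProjection_ray hc' ht) hd).le
    have h0 : dist (F (boundary c.endpoint)) (f (c m)) ≤ ε / 3 := hray c hc (by simp)
    have hm0 : (0 : ℝ≥0) < m := by exact_mod_cast hm
    filter_upwards [(isOpen_coneNhd hc hm0 one_pos).mem_nhds
      ⟨c m, ⟨c, hc, rfl, rfl⟩, by simp⟩]
    rintro z ⟨y, hzy, hy⟩
    have hz : dist (F z) (f (c m)) ≤ ε / 3 := by
      rcases z with x | ξ
      · rw [hp]
        exact (H x y hzy hy).le
      · obtain ⟨c', hc', rfl, rfl⟩ := hzy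
        exact hray c' hc' hy
    linarith [dist_triangle_right (F z) (F (boundary c.endpoint)) (f (c m))]

end VisualCompactification

/-! ### Surjectivity and the image of the boundary -/

-- Take an ultrafilter representing `φ`. If it contains a bounded set, it converges in X by
-- properness. Otherwise the radial projections converge to a ray `c`; both `φ f` and the limit of
-- `f` along `c` are then close to `f (c m)`.
open VisualCompactification in
theorem QGCompactification.exists_eq_ofPoint_or_ray {X : Type u} [MetricSpace X] [ProperSpace X]
    (hX : IsGeodesicSpace X) (x₀ : X) (φ : QGCompactification X) :
    (∃ x, φ = QGCompactification.ofPoint x) ∨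
      ∃ c : GeodesicRay X, ∀ f : slowlyOscillatingAlgebra X,
        Tendsto (fun t => (f : X →ᵇ ℂ) (c t)) atTop (𝓝 (φ f)) := by
  obtain ⟨l, hl⟩ := QGCompactification.exists_ultrafilter_tendsto φ
  by_cases hb : (l : Filter X) ≤ cobounded X
  · right
    obtain ⟨p, hp0, hp, hpp, hpg⟩ := hX.exists_radialProjection x₀
    obtain ⟨c, hc, hpc⟩ := exists_geodesicRay_tendsto hp0 hp hpp l hb
    refine ⟨c, fun f => ?_⟩
    obtain ⟨z, hz⟩ := GeometricallySlowlyOscillating.exists_tendsto_ray hX f.2 c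
    suffices φ f = z by rwa [this]
    refine eq_of_forall_dist_le fun ε hε => ?_
    obtain ⟨m, hm, H⟩ := GeometricallySlowlyOscillating.exists_forall_dist_lt hX f.2 hc
      (ε := ε / 2) (by positivity)
    have h1 : dist (φ f) ((f : X →ᵇ ℂ) (c m)) ≤ ε / 2 := by
      refine le_of_tendsto ((hl f).dist tendsto_const_nhds) ?_
      have hfar := ((Metric.tendsto_dist_left_cobounded_atTop x₀).mono_left
        hb).eventually_gt_atTop (m : ℝ)
      -- Almost all points of the ultrafilter are farther than `m` from `x₀` and project to within 1
      -- of `c m`.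
      filter_upwards [hfar, Metric.tendsto_nhds.1 (hpc m) 1 one_pos] with x hx hx'
      exact (H x (p m x) ⟨by simpa using hx, hpg m x (by simpa using hx.le)⟩ hx').le
    have h2 : dist z ((f : X →ᵇ ℂ) (c m)) ≤ ε / 2 := by
      refine le_of_tendsto (hz.dist tendsto_const_nhds) ?_
      filter_upwards [eventually_gt_atTop (m : ℝ≥0)] with t ht
      exact (H _ _ (isProjection_ray hc ht) (by simp)).le
    linarith [dist_triangle_right (φ f) z ((f : X →ᵇ ℂ) (c m))]
  · left
    obtain ⟨s, hs, hsl⟩ := not_forall₂.1 hb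
    have hsb : IsBounded sᶜ := isBounded_compl_iff.2 (isCobounded_def.2 hs)
    have hmem : closure sᶜ ∈ l :=
      Filter.mem_of_superset (Ultrafilter.compl_mem_iff_notMem.2 hsl) subset_closure
    obtain ⟨x, -, hx⟩ := hsb.isCompact_closure.ultrafilter_le_nhds l (le_principal_iff.2 hmem)
    refine ⟨x, WeakDual.CharacterSpace.ext fun f => ?_⟩
    exact tendsto_nhds_unique (hl f) ((f : X →ᵇ ℂ).continuous.continuousAt.mono_left hx)

/-- No point of `X` is the limit of a geodesic ray. -/
theorem QGCompactification.mem_corona_of_tendsto_ray {X : Type u} [MetricSpace X]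
    {φ : QGCompactification X} (c : GeodesicRay X) (h : ∀ f : slowlyOscillatingAlgebra X,
      Tendsto (fun t => (f : X →ᵇ ℂ) (c t)) atTop (𝓝 (φ f))) :
    φ ∈ QGCompactification.corona X := by
  rintro ⟨x, rfl⟩
  obtain ⟨f, h1, h0⟩ := exists_bump x
  have hf := h f
  rw [QGCompactification.ofPoint_apply, h1] at hf
  have hd := ((Metric.tendsto_dist_left_cobounded_atTop x).comp
    c.tendsto_cobounded).eventually_ge_atTop 1
  have : Tendsto (fun t => (f : X →ᵇ ℂ) (c t)) atTop (𝓝 0) := by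
    refine tendsto_const_nhds.congr' ?_
    filter_upwards [hd] with t ht
    exact (h0 _ ht).symm
  exact one_ne_zero (tendsto_nhds_unique hf this)

theorem proposition4p15 {X : Type u} [MetricSpace X] [ProperSpace X] (hX : IsCAT0Space X)
    (x₀ : X) :
    ∃ F : VisualCompactification x₀ → QGCompactification X,
      Continuous F ∧ Function.Surjective F ∧
      (∀ x : X, F (VisualCompactification.point x) = QGCompactification.ofPoint x) ∧
      F '' Set.range VisualCompactification.boundary = QGCompactification.corona X := by
  obtain ⟨F, hp, hF⟩ := VisualCompactification.exists_extension hX x₀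
  have hray : ∀ φ : QGCompactification X, (∃ x, φ = QGCompactification.ofPoint x) ∨
      ∃ ξ, F (VisualCompactification.boundary ξ) = φ := fun φ =>
    (QGCompactification.exists_eq_ofPoint_or_ray hX.geodesic x₀ φ).imp_right fun ⟨c, hc⟩ =>
      ⟨c.endpoint, WeakDual.CharacterSpace.ext fun f => tendsto_nhds_unique (hF c f) (hc f)⟩
  refine ⟨F, ?_, fun φ => ?_, hp, Set.Subset.antisymm ?_ fun φ hφ => ?_⟩
  · refine Continuous.subtype_mk (WeakDual.continuous_of_continuous_eval fun f => ?_) _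
    exact VisualCompactification.continuous_of_tendsto_ray hX f.2
      (fun x => by rw [hp]; rfl) (fun c => hF c f)
  · rcases hray φ with ⟨x, rfl⟩ | ⟨ξ, hξ⟩
    · exact ⟨_, hp x⟩
    · exact ⟨_, hξ⟩
  · rintro _ ⟨_, ⟨ξ, rfl⟩, rfl⟩
    obtain ⟨c, rfl⟩ := Quotient.exists_rep ξ
    exact QGCompactification.mem_corona_of_tendsto_ray c (hF c)
  · rcases hray φ with ⟨x, rfl⟩ | ⟨ξ, hξ⟩
    · exact absurd ⟨x, rfl⟩ hφ
    · exact ⟨_, ⟨ξ, rfl⟩, hξ⟩
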